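/- Let $S_1,S_2\subseteq\mathbb Z^{+}$ be sets of positive integers and put $E_S(t)=\sum_{s\in S} t^s/s!$. A $(0,1)$ matrix is lonesum if it is the only $(0,1)$ matrix with its row sum vector and column sum vector. A $(0,1)$ matrix is lonesum decomposable if some permutation of its rows and some permutation of its columns bring it into block diagonal form $\mathrm{diag}(L_1,\dots,L_s)$ in which every block $L_i$ is lonesum (zero blocks, and blocks with no rows or no columns, are allowed); its decomposition order is the number of nonzero blocks $L_i$ in such a form, which does not depend on the form. Matrices with $0$ rows or $0$ columns are included. Let $D_{r,S_1,S_2}(n,k)$ (resp. $D_{S_1,S_2}(n,k)$) be the number of $n\times k$ lonesum decomposable matrices of decomposition order $r$ (resp. of any decomposition order) in which every class of mutually equal rows has size in $S_1$ and every class of mutually equal columns has size in $S_2$. Then, as formal power series in $x,y$, for every integer $r\ge 0$, $$\sum_{n=0}^{\infty}\sum_{k=0}^{\infty} D_{r,S_1,S_2}(n,k)\frac{x^n}{n!}\frac{y^k}{k!}=\frac{(1+E_{S_1}(x))(1+E_{S_2}(y))}{r!}\left(\frac{1}{1-E_{S_1}(x)E_{S_2}(y)}-1\right)^r,$$ and $$\sum_{n=0}^{\infty}\sum_{k=0}^{\infty}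 D_{S_1,S_2}(n,k)\frac{x^n}{n!}\frac{y^k}{k!}=(1+E_{S_1}(x))(1+E_{S_2}(y))\exp\left(\frac{1}{1-E_{S_1}(x)E_{S_2}(y)}-1\right).$$ -/

import Mathlib

open scoped Nat

namespace LonesumDecomposable

/-- An `n × k` matrix with entries in `{0, 1}`. -/
abbrev ZeroOneMatrix (n k : ℕ) := Matrix (Fin n) (Fin k) (Fin 2)

/-- The vector of row sums (computed in `ℕ`). -/
def rowSum {n k : ℕ} (M : ZeroOneMatrix n k) (i : Fin n) : ℕ := ∑ j, (M i j : ℕ)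

/-- The vector of column sums (computed in `ℕ`). -/
def colSum {n k : ℕ} (M : ZeroOneMatrix n k) (j : Fin k) : ℕ := ∑ i, (M i j : ℕ)

/-- A lonesum matrix: the only `(0,1)` matrix with its row and column sum vectors. -/
def IsLonesum {n k : ℕ} (M : ZeroOneMatrix n k) : Prop :=
  ∀ N : ZeroOneMatrix n k, rowSum N = rowSum M → colSum N = colSum M → N = M

/-- `M` is, up to a permutation of its rows and a permutation of its columns, the block diagonal
matrix with diagonal blocks `L 0, …, L (s - 1)`, where `L t` has `p t` rows and `q t` columns.
(A bijection of `Fin n` with the row indices of the block matrix is a permutation of the rows.) -/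
def IsBlockForm {n k s : ℕ} (M : ZeroOneMatrix n k) (p q : Fin s → ℕ)
    (L : ∀ t, ZeroOneMatrix (p t) (q t)) : Prop :=
  ∃ (e : Fin n ≃ Σ t, Fin (p t)) (f : Fin k ≃ Σ t, Fin (q t)),
    M = (Matrix.blockDiagonal' L).submatrix e f

/-- Lonesum decomposable: by permuting rows and columns, `M` can be written as a block diagonal
matrix all of whose diagonal blocks are lonesum. -/
def IsLonesumDecomposable {n k : ℕ} (M : ZeroOneMatrix n k) : Prop :=
  ∃ (s : ℕ) (p q : Fin s → ℕ) (L : ∀ t, ZeroOneMatrix (p t) (q t)),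
    (∀ t, IsLonesum (L t)) ∧ IsBlockForm M p q L

/-- `M` is lonesum decomposable of decomposition order `r`: it has a block diagonal form with
lonesum diagonal blocks, exactly `r` of which are nonzero. (Zero blocks, which only collect
all-zero rows and all-zero columns, do not count.) -/
def HasDecompositionOrder {n k : ℕ} (M : ZeroOneMatrix n k) (r : ℕ) : Prop :=
  ∃ (s : ℕ) (p q : Fin s → ℕ) (L : ∀ t, ZeroOneMatrix (p t) (q t)),
    (∀ t, IsLonesum (L t)) ∧ IsBlockForm M p q L ∧
      (Finset.univ.filter fun t => L t ≠ 0).card = r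

/-- Every class of equal rows has size in `S₁`, and every class of equal columns has size
in `S₂`. -/
def IsRestricted (S₁ S₂ : Set ℕ) {n k : ℕ} (M : ZeroOneMatrix n k) : Prop :=
  (∀ i : Fin n, (Finset.univ.filter fun i' => M.row i' = M.row i).card ∈ S₁) ∧
  (∀ j : Fin k, (Finset.univ.filter fun j' => M.col j' = M.col j).card ∈ S₂)

/-- `D_{r,S₁,S₂}(n,k)`. -/
noncomputable def numOfOrder (r : ℕ) (S₁ S₂ : Set ℕ) (n k : ℕ) : ℕ :=
  Nat.card {M : ZeroOneMatrix n k // HasDecompositionOrder M r ∧ IsRestricted S₁ S₂ M}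

/-- `D_{S₁,S₂}(n,k)`. -/
noncomputable def numDecomposable (S₁ S₂ : Set ℕ) (n k : ℕ) : ℕ :=
  Nat.card {M : ZeroOneMatrix n k // IsLonesumDecomposable M ∧ IsRestricted S₁ S₂ M}

/-- Formal power series over `ℚ` in two variables: `x = X 0` and `y = X 1`. -/
abbrev BivariateSeries := MvPowerSeries (Fin 2) ℚ

/-- The bivariate exponential generating function `∑ a(n,k) (x^n / n!) (y^k / k!)`. -/
noncomputable def egf (a : ℕ → ℕ → ℕ) : BivariateSeries :=
  fun d => (a (d 0) (d 1) : ℚ) / ((d 0)! * (d 1)!)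

/-- `E_S(t) = ∑_{s ∈ S} t^s / s!`. -/
noncomputable def E (S : Set ℕ) : PowerSeries ℚ :=
  PowerSeries.mk (S.indicator fun s => 1 / (s ! : ℚ))

/-- `E_S(x)` as a bivariate series. -/
noncomputable def Ex (S : Set ℕ) : BivariateSeries := (E S).subst (MvPowerSeries.X 0 : BivariateSeries)

/-- `E_S(y)` as a bivariate series. -/
noncomputable def Ey (S : Set ℕ) : BivariateSeries := (E S).subst (MvPowerSeries.X 1 : BivariateSeries)

end LonesumDecomposable

namespace LonesumDecomposable

/-! The rows of a lonesum matrix form a chain under inclusion of supports, so a nonzero lonesum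
block is a staircase: for some `m > 0` its nonzero rows and its nonzero columns both fall into
exactly `m` levels, and an entry is 1 iff row level ≤ column level. A decomposable matrix of order
`r` is therefore given by a labelling `IsLabelling` of its rows and columns by (block, level), zero
rows and columns staying unlabelled. Levels are intrinsic, so two labellings differ by a permutation
of the blocks and each matrix has exactly `r!` of them (`nonempty_equiv_labellings`).

Two rows are equal iff their labels are, so the conditions on class sizes become conditions on
fibres of the label maps. For fixed `m`, the exponential formula counts row labellings by `(1 + E
S₁) * E S₁ ^ ∑ m t`, where `1 +` allows no unlabelled row; columns are similar
(`card_restrictedLevels`). Summing over all `m` with every `m t ≥ 1` gives the `r`-th power of the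
geometric series `w + w² + ⋯` in `w = Ex S₁ * Ey S₂`. Division by `r!`, and then summation over `r`,
yields the two formulas. Infinite sums are handled coefficientwise: `X 0` divides `w`, so only
finitely many terms matter. -/

/-- A labelling of order `r` of a relation: every row and every column is either unlabelled or
carries a block and a level in that block, the levels used in block `t` being those below
`m t > 0`, and related pairs are those in a common block with row level at most column level. -/
def IsLabelling {α β : Type*} {r : ℕ} (R : α → β → Prop)
    (f : α → Option (Fin r × ℕ)) (g : β → Option (Fin r × ℕ)) (m : Fin r → ℕ) : Prop :=
  (∀ t, 0 < m t) ∧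
  (∀ t a, (∃ i, f i = some (t, a)) ↔ a < m t) ∧
  (∀ t b, (∃ j, g j = some (t, b)) ↔ b < m t) ∧
  ∀ i j, R i j ↔ ∃ t a b, f i = some (t, a) ∧ g j = some (t, b) ∧ a ≤ b

/-! ### Uniqueness of labellings up to renaming blocks -/

namespace IsLabelling

variable {α β : Type*} {r r' : ℕ} {R : α → β → Prop}
  {f : α → Option (Fin r × ℕ)} {g : β → Option (Fin r × ℕ)} {m : Fin r → ℕ}
  {f' : α → Option (Fin r' × ℕ)} {g' : β → Option (Fin r' × ℕ)} {m' : Fin r' → ℕ}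

/-- Rows and columns use the same levels, so a labelled row is related to some column at its own
level. This diagonal incidence drives the lemmas below. -/
lemma row_none_iff (h : IsLabelling R f g m) (i : α) : f i = none ↔ ∀ j, ¬ R i j := by
  obtain ⟨-, hf, hg, hR⟩ := h
  constructor
  · intro hi j hj
    obtain ⟨t, a, b, h1, -⟩ := (hR i j).1 hj
    simp [hi] at h1
  · intro hi
    by_contra hne
    obtain ⟨⟨t, a⟩, hta⟩ := Option.ne_none_iff_exists'.1 hne
    obtain ⟨j, hj⟩ := (hg t a).2 ((hf t a).1 ⟨i, hta⟩)
    exact hi j ((hR i j).2 ⟨t, a, a, hta, hj, le_rfl⟩)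

lemma col_none_iff (h : IsLabelling R f g m) (j : β) : g j = none ↔ ∀ i, ¬ R i j := by
  obtain ⟨-, hf, hg, hR⟩ := h
  constructor
  · intro hj i hi
    obtain ⟨t, a, b, -, h1, -⟩ := (hR i j).1 hi
    simp [hj] at h1
  · intro hj
    by_contra hne
    obtain ⟨⟨t, a⟩, hta⟩ := Option.ne_none_iff_exists'.1 hne
    obtain ⟨i, hi⟩ := (hf t a).2 ((hg t a).1 ⟨j, hta⟩)
    exact hj i ((hR i j).2 ⟨t, a, a, hi, hta, le_rfl⟩)

lemma row_subset_iff (h : IsLabelling R f g m) {i i' : α} {t t' : Fin r} {a a' : ℕ}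
    (hi : f i = some (t, a)) (hi' : f i' = some (t', a')) :
    (∀ j, R i j → R i' j) ↔ t = t' ∧ a' ≤ a := by
  obtain ⟨-, hf, hg, hR⟩ := h
  constructor
  · intro H
    obtain ⟨j, hj⟩ := (hg t a).2 ((hf t a).1 ⟨i, hi⟩)
    obtain ⟨s, c, d, h1, h2, h3⟩ := (hR i' j).1 (H j ((hR i j).2 ⟨t, a, a, hi, hj, le_rfl⟩))
    simp_all
  · rintro ⟨rfl, hle⟩ j hj
    obtain ⟨s, c, d, h1, h2, h3⟩ := (hR i j).1 hj
    rw [hi] at h1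
    simp only [Option.some.injEq, Prod.mk.injEq] at h1
    obtain ⟨rfl, rfl⟩ := h1
    exact (hR i' j).2 ⟨t, a', d, hi', h2, hle.trans h3⟩

lemma col_subset_iff (h : IsLabelling R f g m) {j j' : β} {t t' : Fin r} {b b' : ℕ}
    (hj : g j = some (t, b)) (hj' : g j' = some (t', b')) :
    (∀ i, R i j → R i j') ↔ t = t' ∧ b ≤ b' := by
  obtain ⟨-, hf, hg, hR⟩ := h
  constructor
  · intro H
    obtain ⟨i, hi⟩ := (hf t b).2 ((hg t b).1 ⟨j, hj⟩)
    obtain ⟨s, c, d, h1, h2, h3⟩ := (hR i j').1 (H i ((hR i j).2 ⟨t, b, b, hi, hj, le_rfl⟩))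
    simp_all
  · rintro ⟨rfl, hle⟩ i hi
    obtain ⟨s, c, d, h1, h2, h3⟩ := (hR i j).1 hi
    rw [hj] at h2
    simp only [Option.some.injEq, Prod.mk.injEq] at h2
    obtain ⟨rfl, rfl⟩ := h2
    exact (hR i j').2 ⟨t, c, b', h1, hj', h3.trans hle⟩

lemma row_eq_iff (h : IsLabelling R f g m) (i i' : α) :
    (∀ j, R i j ↔ R i' j) ↔ f i = f i' := by
  constructor
  · intro H
    rcases hi : f i with _ | ⟨t, a⟩
    · rw [eq_comm, h.row_none_iff]
      intro j
      rw [← H]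
      exact (h.row_none_iff i).1 hi j
    · rcases hi' : f i' with _ | ⟨t', a'⟩
      · have : f i = none := by
          rw [h.row_none_iff]
          intro j
          rw [H]
          exact (h.row_none_iff i').1 hi' j
        simp [this] at hi
      · obtain ⟨rfl, h1⟩ := (h.row_subset_iff hi hi').1 fun j => (H j).1
        obtain ⟨-, h2⟩ := (h.row_subset_iff hi' hi).1 fun j => (H j).2
        rw [le_antisymm h2 h1]
  · intro H j
    rw [h.2.2.2, h.2.2.2, H]

lemma col_eq_iff (h : IsLabelling R f g m) (j j' : β) :
    (∀ i, R i j ↔ R i j') ↔ g j = g j' := by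
  constructor
  · intro H
    rcases hj : g j with _ | ⟨t, a⟩
    · rw [eq_comm, h.col_none_iff]
      intro i
      rw [← H]
      exact (h.col_none_iff j).1 hj i
    · rcases hj' : g j' with _ | ⟨t', a'⟩
      · have : g j = none := by
          rw [h.col_none_iff]
          intro i
          rw [H]
          exact (h.col_none_iff j').1 hj' i
        simp [this] at hj
      · obtain ⟨rfl, h1⟩ := (h.col_subset_iff hj hj').1 fun i => (H i).1
        obtain ⟨-, h2⟩ := (h.col_subset_iff hj' hj).1 fun i => (H i).2
        rw [le_antisymm h1 h2]
  · intro H i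
    rw [h.2.2.2, h.2.2.2, H]

/-- A row at level `a` lies below a strict chain of `a` larger rows, a fact about `R` alone; hence
levels do not depend on the labelling. -/
lemma row_level_le (h : IsLabelling R f g m) (h' : IsLabelling R f' g' m') (a : ℕ) :
    ∀ {i : α} {t : Fin r} {t' : Fin r'} {a' : ℕ}, f i = some (t, a) → f' i = some (t', a') →
      a ≤ a' := by
  induction a with
  | zero => intros; exact Nat.zero_le _
  | succ a ih =>
    intro i t t' a' hi hi'
    obtain ⟨i₀, hi₀⟩ := (h.2.1 t a).2 ((Nat.lt_succ_self a).trans ((h.2.1 t _).1 ⟨i, hi⟩))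
    have hsub := (h.row_subset_iff hi hi₀).2 ⟨rfl, a.le_succ⟩
    rcases hi₀' : f' i₀ with _ | ⟨s, c⟩
    · rw [h'.row_none_iff, ← h.row_none_iff, hi₀] at hi₀'
      simp at hi₀'
    · obtain ⟨rfl, hle⟩ := (h'.row_subset_iff hi' hi₀').1 hsub
      have hne : c ≠ a' := by
        rintro rfl
        have := (h.row_subset_iff hi₀ hi).1 ((h'.row_subset_iff hi₀' hi').2 ⟨rfl, le_rfl⟩)
        omega
      have := ih hi₀ hi₀'
      omega

lemma row_level_eq (h : IsLabelling R f g m) (h' : IsLabelling R f' g' m') {a a' : ℕ}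
    {i : α} {t : Fin r} {t' : Fin r'} (hi : f i = some (t, a)) (hi' : f' i = some (t', a')) :
    a = a' :=
  le_antisymm (h.row_level_le h' a hi hi') (h'.row_level_le h a' hi' hi)

/-- Two labellings of the same relation differ by an injective renaming of the blocks. -/
lemma exists_relabel (h : IsLabelling R f g m) (h' : IsLabelling R f' g' m') :
    ∃ π : Fin r → Fin r', Function.Injective π ∧
      (∀ i, f' i = (f i).map (Prod.map π id)) ∧ ∀ j, g' j = (g j).map (Prod.map π id) := by
  -- A level-0 row is maximal in its block and serves to identify the block in the other labelling.
  have htop : ∀ t, ∃ i, f i = some (t, 0) := fun t => (h.2.1 t 0).2 (h.1 t)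
  choose top htop using htop
  have htop' : ∀ t, ∃ s, f' (top t) = some (s, 0) := by
    intro t
    rcases hi : f' (top t) with _ | ⟨s, c⟩
    · rw [h'.row_none_iff, ← h.row_none_iff, htop] at hi
      simp at hi
    · exact ⟨s, by rw [h.row_level_eq h' (htop t) hi]⟩
  choose π hπ using htop'
  have hrow : ∀ {i t a}, f i = some (t, a) → f' i = some (π t, a) := by
    intro i t a hi
    rcases hi' : f' i with _ | ⟨s, c⟩
    · rw [h'.row_none_iff, ← h.row_none_iff, hi] at hi'
      simp at hi'
    · obtain ⟨rfl, -⟩ := (h'.row_subset_iff hi' (hπ t)).1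
        ((h.row_subset_iff hi (htop t)).2 ⟨rfl, Nat.zero_le _⟩)
      rw [h.row_level_eq h' hi hi']
  have hinj : Function.Injective π := by
    intro t t' htt
    have := (h'.row_eq_iff (top t) (top t')).2 (by rw [hπ, hπ, htt])
    have := (h.row_eq_iff _ _).1 this
    rw [htop, htop] at this
    simpa using this
  refine ⟨π, hinj, fun i => ?_, fun j => ?_⟩
  · rcases hi : f i with _ | ⟨t, a⟩
    · simpa [h'.row_none_iff, ← h.row_none_iff] using hi
    · simpa using hrow hi
  · rcases hj : g j with _ | ⟨t, b⟩
    · simpa [h'.col_none_iff, ← h.col_none_iff] using hj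
    -- Column labels follow from row labels: the row at level `b` gives `b ≤ d`, and a row at level
    -- `d` of the second labelling gives `d ≤ b`.
    · obtain ⟨i, hi⟩ := (h.2.1 t b).2 ((h.2.2.1 t b).1 ⟨j, hj⟩)
      obtain ⟨s, c, d, h1, h2, h3⟩ :=
        (h'.2.2.2 i j).1 ((h.2.2.2 i j).2 ⟨t, b, b, hi, hj, le_rfl⟩)
      rw [hrow hi] at h1
      simp only [Option.some.injEq, Prod.mk.injEq] at h1
      obtain ⟨rfl, rfl⟩ := h1
      obtain ⟨i', hi'⟩ := (h'.2.1 (π t) d).2 ((h'.2.2.1 _ d).1 ⟨j, h2⟩)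
      obtain ⟨s, c, e, h4, h5, h6⟩ :=
        (h.2.2.2 i' j).1 ((h'.2.2.2 i' j).2 ⟨π t, d, d, hi', h2, le_rfl⟩)
      rw [hj] at h5
      simp only [Option.some.injEq, Prod.mk.injEq] at h5
      obtain ⟨rfl, rfl⟩ := h5
      have := h.row_level_eq h' h4 hi'
      have : d = b := by omega
      simp [h2, this]

lemma order_le (h : IsLabelling R f g m) (h' : IsLabelling R f' g' m') : r ≤ r' := by
  obtain ⟨π, hπ, -⟩ := h.exists_relabel h'
  simpa using Fintype.card_le_of_injective π hπ

lemma relabel (h : IsLabelling R f g m) (π : Equiv.Perm (Fin r)) :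
    IsLabelling R (fun i => (f i).map (Prod.map π id)) (fun j => (g j).map (Prod.map π id))
      (m ∘ π.symm) := by
  have key : ∀ (o : Option (Fin r × ℕ)) t a,
      o.map (Prod.map π id) = some (t, a) ↔ o = some (π.symm t, a) := by
    rintro (_ | ⟨s, c⟩) t a
    · simp
    · simp [Equiv.eq_symm_apply]
  refine ⟨fun t => h.1 _, fun t a => ?_, fun t a => ?_, fun i j => ?_⟩
  · simp only [key]; exact h.2.1 _ _
  · simp only [key]; exact h.2.2.1 _ _
  · simp only [key, h.2.2.2 i j]
    constructor
    · rintro ⟨t, a, b, h1⟩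
      exact ⟨π t, a, b, by simpa using h1⟩
    · rintro ⟨t, a, b, h1⟩
      exact ⟨π.symm t, a, b, h1⟩

end IsLabelling

/-- A relation with a labelling of order `r` has exactly `r!` of them. -/
lemma nonempty_equiv_labellings {α β : Type*} {r : ℕ} {R : α → β → Prop}
    (h : ∃ (f : α → Option (Fin r × ℕ)) (g : β → Option (Fin r × ℕ)) (m : Fin r → ℕ),
      IsLabelling R f g m) :
    Nonempty (Equiv.Perm (Fin r) ≃
      {p : (α → Option (Fin r × ℕ)) × (β → Option (Fin r × ℕ)) //
        ∃ m, IsLabelling R p.1 p.2 m}) := by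
  obtain ⟨f, g, m, h⟩ := h
  refine ⟨Equiv.ofBijective (fun π => ⟨(fun i => (f i).map (Prod.map π id),
    fun j => (g j).map (Prod.map π id)), _, h.relabel π⟩) ⟨?_, ?_⟩⟩
  · intro π ρ hπρ
    ext t
    obtain ⟨i, hi⟩ := (h.2.1 t 0).2 (h.1 t)
    have := congrFun (congrArg (fun p => p.1.1) hπρ) i
    simp only [hi, Option.map_some, Prod.map_apply, Option.some.injEq, Prod.mk.injEq] at this
    rw [this.1]
  · rintro ⟨⟨f', g'⟩, m', h'⟩
    obtain ⟨π, hπ, h1, h2⟩ := h.exists_relabel h'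
    refine ⟨Equiv.ofBijective π (Finite.injective_iff_bijective.1 hπ), ?_⟩
    ext1
    exact Prod.ext (funext fun i => (h1 i).symm) (funext fun j => (h2 j).symm)

/-! ### Lonesum matrices and staircases -/

/-- In a lonesum matrix no pair of rows and pair of columns cut out a permutation matrix. -/
lemma IsLonesum.false_of_switch {n k : ℕ} {M : ZeroOneMatrix n k} (hM : IsLonesum M)
    {i i' : Fin n} {j j' : Fin k} (h1 : M i j = 1) (h2 : M i j' = 0) (h3 : M i' j = 0)
    (h4 : M i' j' = 1) : False := by
  have hi : i ≠ i' := by rintro rfl; simp [h1] at h3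
  have hj : j ≠ j' := by rintro rfl; simp [h1] at h2
  let N : ZeroOneMatrix n k := fun x y =>
    if x = i ∨ x = i' then M x (Equiv.swap j j' y) else M x y
  -- On a 2 × 2 permutation matrix, swapping columns equals swapping rows. The first description
  -- preserves row sums, this one column sums.
  have hN : ∀ x y, N x y = if y = j ∨ y = j' then M (Equiv.swap i i' x) y else M x y := by
    intro x y
    simp only [N, Equiv.swap_apply_def]
    split_ifs <;> simp_all
  have hrow : rowSum N = rowSum M := by
    funext x
    simp only [rowSum, N]
    split_ifs
    · exact Equiv.sum_comp (Equiv.swap j j') fun y => (M x y : ℕ)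
    · rfl
  have hcol : colSum N = colSum M := by
    funext y
    simp only [colSum, hN]
    split_ifs
    · exact Equiv.sum_comp (Equiv.swap i i') fun x => (M x y : ℕ)
    · rfl
  have := congrFun (congrFun (hM N hrow hcol) i) j
  simp [N, h1, h2] at this

lemma eq_zero_of_ne_one {a : Fin 2} (h : a ≠ 1) : a = 0 := by omega

/-- The rows of a lonesum matrix form a chain. -/
lemma IsLonesum.row_total {n k : ℕ} {M : ZeroOneMatrix n k} (hM : IsLonesum M) (i i' : Fin n) :
    (∀ j, M i j = 1 → M i' j = 1) ∨ ∀ j, M i' j = 1 → M i j = 1 := by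
  by_contra! h
  obtain ⟨⟨j, h1, h2⟩, j', h3, h4⟩ := h
  exact hM.false_of_switch h1 (eq_zero_of_ne_one h4) (eq_zero_of_ne_one h2) h3

/-- A staircase matrix is lonesum. -/
lemma isLonesum_of_levels {n k : ℕ} {M : ZeroOneMatrix n k} (a : Fin n → ℤ) (b : Fin k → ℤ)
    (h : ∀ i j, M i j = 1 ↔ a i ≤ b j) : IsLonesum M := by
  intro N hrow hcol
  set D : Fin n → Fin k → ℤ := fun i j => ((N i j : ℕ) : ℤ) - ((M i j : ℕ) : ℤ) with hD
  have hr : ∀ i, ∑ j, D i j = 0 := by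
    intro i
    have := congrFun hrow i
    simp only [rowSum] at this
    simp only [hD, Finset.sum_sub_distrib]
    rw [sub_eq_zero]
    exact_mod_cast this
  have hc : ∀ j, ∑ i, D i j = 0 := by
    intro j
    have := congrFun hcol j
    simp only [colSum] at this
    simp only [hD, Finset.sum_sub_distrib]
    rw [sub_eq_zero]
    exact_mod_cast this
  -- The weight is odd, hence nonzero, and positive exactly where `M` is 1, where `D ≤ 0`. Being a
  -- function of `i` plus a function of `j`, it has zero total against `D`, so every product
  -- vanishes.
  have hle : ∀ i j, D i j * (2 * b j - 2 * a i + 1) ≤ 0 := by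
    intro i j
    have hNlt := (N i j).isLt
    by_cases hij : M i j = 1
    · have := (h i j).1 hij
      refine mul_nonpos_of_nonpos_of_nonneg ?_ (by linarith)
      simp only [hD, hij]
      have : ((1 : Fin 2) : ℕ) = 1 := rfl
      omega
    · have := mt (h i j).2 hij
      refine mul_nonpos_of_nonneg_of_nonpos ?_ (by omega)
      simp [hD, eq_zero_of_ne_one hij]
  have hsum : ∑ p : Fin n × Fin k, D p.1 p.2 * (2 * b p.2 - 2 * a p.1 + 1) = 0 := by
    have h1 : ∑ p : Fin n × Fin k, D p.1 p.2 * (2 * b p.2) = 0 := by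
      rw [Fintype.sum_prod_type_right]
      simp [← Finset.sum_mul, hc]
    have h2 : ∑ p : Fin n × Fin k, D p.1 p.2 * (1 - 2 * a p.1) = 0 := by
      rw [Fintype.sum_prod_type]
      simp [← Finset.sum_mul, hr]
    rw [← add_zero (0 : ℤ)]
    nth_rewrite 1 [← h1]
    rw [← h2, ← Finset.sum_add_distrib]
    exact Finset.sum_congr rfl fun p _ => by ring
  have hzero := (Finset.sum_eq_zero_iff_of_nonpos fun p _ => hle p.1 p.2).1 hsum
  ext i j
  have := hzero (i, j) (Finset.mem_univ _)
  rcases mul_eq_zero.1 this with h0 | h0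
  · simp only [hD] at h0
    omega
  · simp only at h0
    omega

/-- A relation between finite types whose rows form a chain is a staircase. -/
lemma exists_levels {α β : Type*} [Fintype α] (R : α → β → Prop)
    (hR : ∀ i i', (∀ j, R i j → R i' j) ∨ ∀ j, R i' j → R i j) :
    ∃ (m : ℕ) (A : α → Option ℕ) (B : β → Option ℕ),
      (∀ a, (∃ i, A i = some a) ↔ a < m) ∧ (∀ b, (∃ j, B j = some b) ↔ b < m) ∧
      ∀ i j, R i j ↔ ∃ a b, A i = some a ∧ B j = some b ∧ a ≤ b := by
  classical
  let supp : α → Set β := fun i => {j | R i j}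
  let C : Finset (Set β) := (Finset.univ.image supp).filter Set.Nonempty
  have hC : ∀ S, S ∈ C ↔ (∃ i, supp i = S) ∧ S.Nonempty := by simp [C]
  have hchain : ∀ S ∈ C, ∀ T ∈ C, S ⊆ T ∨ T ⊆ S := by
    intro S hS T hT
    obtain ⟨⟨i, rfl⟩, -⟩ := (hC S).1 hS
    obtain ⟨⟨i', rfl⟩, -⟩ := (hC T).1 hT
    exact hR i i'
  -- `lev` counts the strictly larger supports, `cnt` the supports containing a column. In a chain,
  -- `y ∈ S` iff `lev S < cnt y`, so the column level is `cnt y - 1`.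
  let lev : Set β → ℕ := fun S => (C.filter (S ⊂ ·)).card
  let cnt : β → ℕ := fun y => (C.filter (y ∈ ·)).card
  have hlt : ∀ S ∈ C, lev S < C.card := fun S hS =>
    Finset.card_lt_card ⟨Finset.filter_subset _ _, fun h => by simpa using h hS⟩
  have hanti : ∀ S ∈ C, ∀ T ∈ C, S ⊂ T → lev T < lev S := by
    intro S hS T hT hST
    refine Finset.card_lt_card ⟨fun U hU => ?_, fun h => ?_⟩
    · rw [Finset.mem_filter] at hU ⊢
      exact ⟨hU.1, hST.trans hU.2⟩
    · have := h (Finset.mem_filter.2 ⟨hT, hST⟩)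
      simp at this
  have hinj : Set.InjOn lev C := by
    intro S hS T hT hST
    by_contra hne
    rcases hchain S hS T hT with h | h
    · exact (hanti S hS T hT (h.ssubset_of_ne hne)).ne' hST
    · exact (hanti T hT S hS (h.ssubset_of_ne (Ne.symm hne))).ne hST
  have hsurj : ∀ a < C.card, ∃ S ∈ C, lev S = a := by
    intro a ha
    have := Finset.surjOn_of_injOn_of_card_le (s := C) (t := Finset.range C.card) lev
      (fun S hS => by simpa using hlt S hS) hinj (by simp)
    obtain ⟨S, hS, h⟩ := this (show a ∈ (Finset.range C.card : Set ℕ) by simpa using ha)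
    exact ⟨S, hS, h⟩
  have hkey : ∀ S ∈ C, ∀ y, y ∈ S ↔ lev S < cnt y := by
    intro S hS y
    constructor
    · intro hy
      refine Finset.card_lt_card ⟨fun U hU => ?_, fun h => ?_⟩
      · rw [Finset.mem_filter] at hU ⊢
        exact ⟨hU.1, hU.2.1 hy⟩
      · simpa using h (Finset.mem_filter.2 ⟨hS, hy⟩)
    · intro h
      by_contra hy
      refine h.not_ge (Finset.card_le_card fun U hU => ?_)
      rw [Finset.mem_filter] at hU ⊢
      refine ⟨hU.1, ?_⟩
      have hUS : ¬ U ⊆ S := fun h' => hy (h' hU.2)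
      exact ⟨(hchain S hS U hU.1).resolve_right hUS, hUS⟩
  have hcnt : ∀ y, cnt y ≤ C.card := fun y => Finset.card_le_card (Finset.filter_subset _ _)
  refine ⟨C.card, fun i => if (supp i).Nonempty then some (lev (supp i)) else none,
    fun y => if cnt y = 0 then none else some (cnt y - 1), fun a => ?_, fun b => ?_,
    fun i y => ?_⟩
  · constructor
    · rintro ⟨i, hi⟩
      dsimp only at hi
      split_ifs at hi with h
      rw [← Option.some.inj hi]
      exact hlt _ ((hC _).2 ⟨⟨i, rfl⟩, h⟩)
    · intro ha
      obtain ⟨S, hS, rfl⟩ := hsurj a ha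
      obtain ⟨⟨i, rfl⟩, h⟩ := (hC S).1 hS
      exact ⟨i, if_pos h⟩
  · constructor
    · rintro ⟨y, hy⟩
      dsimp only at hy
      split_ifs at hy with h
      have := Option.some.inj hy
      have := hcnt y
      omega
    · intro hb
      obtain ⟨S, hS, hSb⟩ := hsurj b hb
      -- Take `y` in the support of level `b` but outside that of level `b + 1`, or any point of the
      -- smallest support.
      obtain ⟨y, hy⟩ : ∃ y, cnt y = b + 1 := by
        by_cases hb' : b + 1 < C.card
        · obtain ⟨T, hT, hTb⟩ := hsurj (b + 1) hb'
          have hST : ¬ S ⊆ T := by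
            intro h
            rcases eq_or_ne S T with rfl | hne
            · omega
            · have := hanti S hS T hT (h.ssubset_of_ne hne)
              omega
          obtain ⟨y, hyS, hyT⟩ := Set.not_subset.1 hST
          rw [hkey S hS] at hyS
          rw [hkey T hT] at hyT
          exact ⟨y, by omega⟩
        · obtain ⟨y, hyS⟩ := ((hC S).1 hS).2
          rw [hkey S hS] at hyS
          have := hcnt y
          exact ⟨y, by omega⟩
      exact ⟨y, by simp [hy]⟩
  · constructor
    · intro h
      have hne : (supp i).Nonempty := ⟨y, h⟩
      have := (hkey _ ((hC _).2 ⟨⟨i, rfl⟩, hne⟩) y).1 h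
      exact ⟨lev (supp i), cnt y - 1, if_pos hne, if_neg (by omega), by omega⟩
    · rintro ⟨a, b, ha, hb, hab⟩
      dsimp only at ha hb
      split_ifs at ha with hne
      split_ifs at hb with h0
      refine (hkey _ ((hC _).2 ⟨⟨i, rfl⟩, hne⟩) y).2 ?_
      have := Option.some.inj ha
      have := Option.some.inj hb
      omega

/-! ### Block forms and labellings -/

/-- A partition of rows and columns into blocks outside of which `M` vanishes gives a block
form. -/
lemma isBlockForm_of_fibers {n k s : ℕ} (M : ZeroOneMatrix n k) (τ : Fin n → Fin s)
    (σ : Fin k → Fin s) (h : ∀ i j, M i j = 1 → τ i = σ j) :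
    IsBlockForm M (fun t => Fintype.card {i // τ i = t}) (fun t => Fintype.card {j // σ j = t})
      (fun t => M.submatrix (fun x => ((Fintype.equivFin {i // τ i = t}).symm x : Fin n))
        (fun y => ((Fintype.equivFin {j // σ j = t}).symm y : Fin k))) := by
  refine ⟨(Equiv.sigmaFiberEquiv τ).symm.trans (Equiv.sigmaCongrRight fun t =>
    Fintype.equivFin {i // τ i = t}), (Equiv.sigmaFiberEquiv σ).symm.trans
    (Equiv.sigmaCongrRight fun t => Fintype.equivFin {j // σ j = t}), ?_⟩
  refine Matrix.ext fun i j => ?_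
  have aux : ∀ (t u : Fin s) (x : {i // τ i = t}) (y : {j // σ j = u}),
      M x y = Matrix.blockDiagonal'
        (fun t => M.submatrix (fun x => ((Fintype.equivFin {i // τ i = t}).symm x : Fin n))
          (fun y => ((Fintype.equivFin {j // σ j = t}).symm y : Fin k)))
        ⟨t, Fintype.equivFin _ x⟩ ⟨u, Fintype.equivFin _ y⟩ := by
    intro t u x y
    by_cases htu : t = u
    · subst htu
      simp [Matrix.blockDiagonal'_apply_eq]
    · rw [Matrix.blockDiagonal'_apply_ne _ _ _ htu]
      refine eq_zero_of_ne_one fun hM => htu ?_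
      rw [← x.2, ← y.2]
      exact h _ _ hM
  exact aux (τ i) (σ j) ⟨i, rfl⟩ ⟨j, rfl⟩

lemma IsLabelling.hasDecompositionOrder {n k r : ℕ} {M : ZeroOneMatrix n k}
    {f : Fin n → Option (Fin r × ℕ)} {g : Fin k → Option (Fin r × ℕ)} {m : Fin r → ℕ}
    (h : IsLabelling (fun i j => M i j = 1) f g m) : HasDecompositionOrder M r := by
  have hR : ∀ i j, M i j = 1 ↔ _ := h.2.2.2
  -- Block 0 is an extra zero block for unlabelled rows and columns; labelled block `t` becomes
  -- block `t + 1`.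
  let blk : Option (Fin r × ℕ) → Fin (r + 1) := fun o => o.elim 0 fun p => p.1.succ
  have hblk : ∀ o t, blk o = Fin.succ t → ∃ a, o = some (t, a) := by
    rintro (_ | ⟨s, a⟩) t ho
    · exact absurd ho (Fin.succ_ne_zero t).symm
    · exact ⟨a, by rw [Fin.succ_injective _ ho]⟩
  have hblk0 : ∀ o, blk o = 0 → o = none := by
    rintro (_ | ⟨s, a⟩) ho
    · rfl
    · exact absurd ho (Fin.succ_ne_zero s)
  have hM : ∀ i j, M i j = 1 → blk (f i) = blk (g j) := by
    intro i j hij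
    obtain ⟨t, a, b, h1, h2, -⟩ := (h.2.2.2 i j).1 hij
    simp [h1, h2, blk]
  refine ⟨r + 1, _, _, _, fun t => ?_, isBlockForm_of_fibers M (blk ∘ f) (blk ∘ g) hM, ?_⟩
  · refine Fin.cases ?_ (fun t => ?_) t
    -- Row level 1 never lies below column level 0: the zero matrix as a staircase.
    · refine isLonesum_of_levels (fun _ => 1) (fun _ => 0) fun x y => ?_
      have hx := hblk0 _ ((Fintype.equivFin {i // (blk ∘ f) i = 0}).symm x).2
      rw [Matrix.submatrix_apply, hR]
      simp [-Function.comp_apply, hx]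
    · let lev : Option (Fin r × ℕ) → ℤ := fun o => o.elim 0 fun p => p.2
      refine isLonesum_of_levels
        (fun x => lev (f ((Fintype.equivFin {i // (blk ∘ f) i = t.succ}).symm x)))
        (fun y => lev (g ((Fintype.equivFin {j // (blk ∘ g) j = t.succ}).symm y)))
        fun x y => ?_
      obtain ⟨a, hx⟩ := hblk _ t ((Fintype.equivFin {i // (blk ∘ f) i = t.succ}).symm x).2
      obtain ⟨b, hy⟩ := hblk _ t ((Fintype.equivFin {j // (blk ∘ g) j = t.succ}).symm y).2
      rw [Matrix.submatrix_apply, hR]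
      simp [-Function.comp_apply, hx, hy, lev]
  · refine Eq.trans (congrArg Finset.card (?_ : _ = Finset.univ.map (Fin.succEmb r))) (by simp)
    ext t
    simp only [Finset.mem_filter, Finset.mem_univ, true_and, Finset.mem_map, Fin.coe_succEmb]
    refine Fin.cases ?_ (fun t => ?_) t
    · simp only [Fin.succ_ne_zero, exists_false, iff_false, not_not]
      refine Matrix.ext fun x y => ?_
      refine eq_zero_of_ne_one fun hxy => ?_
      have hx := hblk0 _ ((Fintype.equivFin {i // (blk ∘ f) i = 0}).symm x).2
      rw [Matrix.submatrix_apply, hR] at hxy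
      simp [-Function.comp_apply, hx] at hxy
    · refine iff_of_true (fun h0 => ?_) ⟨t, rfl⟩
      obtain ⟨i, hi⟩ := (h.2.1 t 0).2 (h.1 t)
      obtain ⟨j, hj⟩ := (h.2.2.1 t 0).2 (h.1 t)
      have h1 := (h.2.2.2 i j).2 ⟨t, 0, 0, hi, hj, le_rfl⟩
      have h2 := congrFun (congrFun h0 (Fintype.equivFin {i // (blk ∘ f) i = t.succ}
        ⟨i, by simp [hi, blk]⟩)) (Fintype.equivFin {j // (blk ∘ g) j = t.succ}
        ⟨j, by simp [hj, blk]⟩)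
      simp [h1] at h2

lemma HasDecompositionOrder.exists_isLabelling {n k r : ℕ} {M : ZeroOneMatrix n k}
    (h : HasDecompositionOrder M r) :
    ∃ (f : Fin n → Option (Fin r × ℕ)) (g : Fin k → Option (Fin r × ℕ)) (m : Fin r → ℕ),
      IsLabelling (fun i j => M i j = 1) f g m := by
  obtain ⟨s, p, q, L, hL, ⟨e, f, rfl⟩, hr⟩ := h
  have hlev := fun t => exists_levels (fun i j => L t i j = 1) (hL t).row_total
  choose m A B hA hB hAB using hlev
  -- Zero blocks have `m t = 0`, so all their rows and columns stay unlabelled; the nonzero blocks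
  -- are renumbered by `Fin r`.
  let inv := (Finset.univ.filter fun t => L t ≠ 0).orderEmbOfFin hr
  have hinv : ∀ t, L t ≠ 0 → ∃ u, inv u = t := by
    intro t ht
    have : t ∈ Set.range inv := by
      rw [Finset.range_orderEmbOfFin]
      simpa using ht
    exact this
  have hpos : ∀ t, L t ≠ 0 ↔ 0 < m t := by
    intro t
    constructor
    · intro ht
      by_contra h0
      refine ht ?_
      refine Matrix.ext fun x y => ?_
      refine eq_zero_of_ne_one fun hxy => ?_
      obtain ⟨a, b, h1, -⟩ := (hAB t x y).1 hxy
      have := (hA t a).1 ⟨x, h1⟩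
      omega
    · intro h0 ht
      obtain ⟨x, hx⟩ := (hA t 0).2 h0
      obtain ⟨y, hy⟩ := (hB t 0).2 h0
      have := (hAB t x y).2 ⟨0, 0, hx, hy, le_rfl⟩
      simp [ht] at this
  have hex : ∀ (t : Fin s) (o : Option ℕ), (∀ a, o = some a → L t ≠ 0) →
      ∃ o' : Option (Fin r × ℕ), ∀ u a, o' = some (u, a) ↔ inv u = t ∧ o = some a := by
    rintro t (_ | a) ho
    · exact ⟨none, by simp⟩
    · obtain ⟨u, rfl⟩ := hinv t (ho a rfl)
      exact ⟨some (u, a), fun v b => by simp [eq_comm]⟩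
  have hF := fun i => hex (e i).1 (A (e i).1 (e i).2) fun a ha =>
    (hpos _).2 ((Nat.zero_le a).trans_lt ((hA _ a).1 ⟨_, ha⟩))
  have hG := fun j => hex (f j).1 (B (f j).1 (f j).2) fun b hb =>
    (hpos _).2 ((Nat.zero_le b).trans_lt ((hB _ b).1 ⟨_, hb⟩))
  choose F hF using hF
  choose G hG using hG
  refine ⟨F, G, fun u => m (inv u), fun u => ?_, fun u a => ?_, fun u b => ?_, fun i j => ?_⟩
  · rw [← hpos]
    have := Finset.orderEmbOfFin_mem (Finset.univ.filter fun t => L t ≠ 0) hr u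
    exact (Finset.mem_filter.1 this).2
  · rw [← hA]
    simp only [hF]
    constructor
    · rintro ⟨i, h1, h2⟩
      rw [h1]
      exact ⟨_, h2⟩
    · rintro ⟨x, hx⟩
      obtain ⟨i, hi⟩ := e.surjective ⟨inv u, x⟩
      exact ⟨i, by rw [hi], by rw [hi]; exact hx⟩
  · rw [← hB]
    simp only [hG]
    constructor
    · rintro ⟨i, h1, h2⟩
      rw [h1]
      exact ⟨_, h2⟩
    · rintro ⟨x, hx⟩
      obtain ⟨i, hi⟩ := f.surjective ⟨inv u, x⟩
      exact ⟨i, by rw [hi], by rw [hi]; exact hx⟩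
  · simp only [hF, hG, Matrix.submatrix_apply]
    generalize e i = x
    generalize f j = y
    obtain ⟨t, x⟩ := x
    obtain ⟨u, y⟩ := y
    by_cases htu : t = u
    · subst htu
      rw [Matrix.blockDiagonal'_apply_eq, hAB]
      constructor
      · rintro ⟨a, b, h1, h2, h3⟩
        obtain ⟨v, hv⟩ := hinv t ((hpos t).2 ((Nat.zero_le a).trans_lt ((hA _ a).1 ⟨_, h1⟩)))
        exact ⟨v, a, b, ⟨hv, h1⟩, ⟨hv, h2⟩, h3⟩
      · rintro ⟨v, a, b, ⟨-, h1⟩, ⟨-, h2⟩, h3⟩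
        exact ⟨a, b, h1, h2, h3⟩
    · rw [Matrix.blockDiagonal'_apply_ne _ _ _ htu]
      refine iff_of_false (by simp) ?_
      rintro ⟨v, a, b, ⟨h1, -⟩, ⟨h2, -⟩, -⟩
      exact htu (h1.symm.trans h2)

lemma HasDecompositionOrder.unique {n k r r' : ℕ} {M : ZeroOneMatrix n k}
    (h : HasDecompositionOrder M r) (h' : HasDecompositionOrder M r') : r = r' := by
  obtain ⟨f, g, m, h⟩ := h.exists_isLabelling
  obtain ⟨f', g', m', h'⟩ := h'.exists_isLabelling
  exact le_antisymm (h.order_le h') (h'.order_le h)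

/-! ### Exponential formula and counting of label maps -/

/-- The number of maps with prescribed fibre sizes is a multinomial coefficient. -/
lemma card_filter_fiber_card_eq {α γ : Type*} [Fintype α] [DecidableEq α] [Fintype γ]
    [DecidableEq γ] (d : γ → ℕ) (hd : ∑ c, d c = Fintype.card α) :
    (Finset.univ.filter fun f : α → γ =>
      ∀ c, (Finset.univ.filter fun i => f i = c).card = d c).card =
      Nat.multinomial Finset.univ d := by
  -- This power is expanded over maps here and by the multinomial theorem below; the coefficients of
  -- the monomial with exponent `d` are then compared.
  have h1 : (∑ c : γ, (MvPolynomial.X c : MvPolynomial γ ℕ)) ^ Fintype.card α =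
      ∑ f : α → γ, ∏ c, MvPolynomial.X c ^ (Finset.univ.filter fun i => f i = c).card := by
    have : ∏ _i : α, ∑ c : γ, (MvPolynomial.X c : MvPolynomial γ ℕ) =
        ∑ f : α → γ, ∏ i, MvPolynomial.X (f i) := by
      rw [Finset.prod_univ_sum, Fintype.piFinset_univ]
    rw [Finset.prod_const, Finset.card_univ] at this
    rw [this]
    refine Finset.sum_congr rfl fun f _ => ?_
    rw [← Finset.prod_fiberwise' Finset.univ f]
    simp
  rw [Finset.sum_pow_eq_sum_piAntidiag] at h1
  have h2 := congrArg (MvPolynomial.coeff (Finsupp.equivFunOnFinite.symm d)) h1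
  have h3 : ∀ x : γ → ℕ, Finsupp.equivFunOnFinite.symm d =
      Finsupp.indicator Finset.univ (fun i _ => x i) ↔ x = d := by
    intro x
    rw [Finsupp.ext_iff, funext_iff]
    simp [eq_comm]
  simp only [MvPolynomial.coeff_sum, MvPolynomial.coeff_prod_X_pow, h3, ← nsmul_eq_mul,
    MvPolynomial.coeff_smul] at h2
  rw [Finset.sum_eq_single d] at h2
  · rw [if_pos rfl, nsmul_eq_mul, mul_one] at h2
    rw [Finset.card_filter]
    simp only [← funext_iff]
    exact_mod_cast h2.symm
  · intro b _ hb
    simp [hb]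
  · intro h
    simp [hd] at h

/-- The exponential formula for maps with restricted fibre sizes. -/
lemma card_filter_fiber_card_mem {α γ : Type*} [Fintype α] [DecidableEq α] [Fintype γ]
    [DecidableEq γ] (T : γ → Set ℕ)
    [DecidablePred fun f : α → γ => ∀ c, (Finset.univ.filter fun i => f i = c).card ∈ T c] :
    ((Finset.univ.filter fun f : α → γ =>
      ∀ c, (Finset.univ.filter fun i => f i = c).card ∈ T c).card : ℚ) =
      (Fintype.card α)! * PowerSeries.coeff (Fintype.card α) (∏ c, E (T c)) := by
  classical
  let fib : (α → γ) → (γ →₀ ℕ) := fun f =>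
    Finsupp.equivFunOnFinite.symm fun c => (Finset.univ.filter fun i => f i = c).card
  have hfib : ∀ f, fib f ∈ Finset.univ.finsuppAntidiag (Fintype.card α) := by
    intro f
    rw [Finset.mem_finsuppAntidiag]
    refine ⟨?_, Finset.subset_univ _⟩
    simp only [fib, Finsupp.equivFunOnFinite_symm_apply_apply]
    rw [← Finset.card_eq_sum_card_fiberwise (fun _ _ => Finset.mem_coe.2 (Finset.mem_univ _)),
      Finset.card_univ]
  rw [PowerSeries.coeff_prod, Finset.mul_sum,
    Finset.card_eq_sum_card_fiberwise (f := fib) (fun f _ => Finset.mem_coe.2 (hfib f)),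
    Nat.cast_sum]
  refine Finset.sum_congr rfl fun l hl => ?_
  have hl' := (Finset.mem_finsuppAntidiag.1 hl).1
  have hE : ∀ c, PowerSeries.coeff (l c) (E (T c)) =
      if l c ∈ T c then (1 / ((l c)! : ℚ)) else 0 := by
    intro c
    simp [E, Set.indicator_apply]
  simp only [hE]
  by_cases hT : ∀ c, l c ∈ T c
  · simp only [hT, if_true]
    have : (Finset.univ.filter fun f : α → γ =>
        ∀ c, (Finset.univ.filter fun i => f i = c).card ∈ T c).filter (fun f => fib f = l) =
        Finset.univ.filter fun f : α → γ =>
          ∀ c, (Finset.univ.filter fun i => f i = c).card = l c := by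
      ext f
      simp only [Finset.mem_filter, Finset.mem_univ, true_and, fib, Finsupp.ext_iff,
        Finsupp.equivFunOnFinite_symm_apply_apply]
      constructor
      · exact fun h => h.2
      · exact fun h => ⟨fun c => by rw [h]; exact hT c, h⟩
    rw [this, card_filter_fiber_card_eq _ hl', ← hl', ← Nat.multinomial_spec]
    push_cast
    have hne : ∏ c, ((l c)! : ℚ) ≠ 0 :=
      Finset.prod_ne_zero_iff.2 fun c _ => by exact_mod_cast (l c).factorial_ne_zero
    simp only [one_div, Finset.prod_inv_distrib]
    field_simp
  · push Not at hT
    obtain ⟨c, hc⟩ := hT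
    rw [Finset.prod_eq_zero (Finset.mem_univ c) (if_neg hc), mul_zero, Nat.cast_eq_zero,
      Finset.card_eq_zero, Finset.filter_eq_empty_iff]
    rintro f hf rfl
    exact hc ((Finset.mem_filter.1 hf).2 c)

/-- Maps into blocks and levels using exactly the levels below `m t` in block `t`, all of whose
nonempty fibres have size in `S`. -/
abbrev RestrictedLevels (α : Type*) [Fintype α] {r : ℕ} (m : Fin r → ℕ) (S : Set ℕ) :=
  {f : α → Option (Fin r × ℕ) // (∀ t a, (∃ i, f i = some (t, a)) ↔ a < m t) ∧
    ∀ i, (Finset.univ.filter fun i' => f i' = f i).card ∈ S}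

lemma E_insert_zero {S : Set ℕ} (hS : 0 ∉ S) : E (insert 0 S) = 1 + E S := by
  ext n
  rcases Nat.eq_zero_or_pos n with rfl | hn
  · simp [E, hS]
  · by_cases h : n ∈ S <;> simp [E, PowerSeries.coeff_one, hn.ne', h]

/-- The fibre sizes allowed by `S` for labelled elements and by `insert 0 S` for unlabelled
ones. -/
def allowedSizes {r : ℕ} (m : Fin r → ℕ) (S : Set ℕ) (o : Option (Σ t, Fin (m t))) : Set ℕ :=
  o.elim (insert 0 S) fun _ => S

/-- Passing to a finite label type makes the exponential formula applicable. Since `0 ∉ S`, the size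
condition itself forces every level to be used. -/
lemma nonempty_equiv_restrictedLevels (α : Type*) [Fintype α] {r : ℕ} (m : Fin r → ℕ)
    {S : Set ℕ} (hS : 0 ∉ S) :
    Nonempty ({f : α → Option (Σ t, Fin (m t)) //
      ∀ c, (Finset.univ.filter fun i => f i = c).card ∈ allowedSizes m S c} ≃
        RestrictedLevels α m S) := by
  let ι : (Σ t, Fin (m t)) → Fin r × ℕ := fun p => (p.1, p.2)
  have hι : Function.Injective ι := by
    rintro ⟨t, a⟩ ⟨u, b⟩ h
    simp only [ι, Prod.mk.injEq] at h
    obtain ⟨rfl, h⟩ := h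
    rw [Fin.ext h]
  have hι' : Function.Injective (Option.map ι) := Option.map_injective hι
  refine ⟨Equiv.ofBijective (fun f => ⟨fun i => (f.1 i).map ι, fun t a => ⟨?_, ?_⟩,
    fun i => ?_⟩) ⟨?_, ?_⟩⟩
  · rintro ⟨i, hi⟩
    rw [Option.map_eq_some_iff] at hi
    obtain ⟨⟨u, b⟩, -, h⟩ := hi
    simp only [ι, Prod.mk.injEq] at h
    obtain ⟨rfl, rfl⟩ := h
    exact b.2
  · intro ha
    have h := f.2 (some ⟨t, a, ha⟩)
    have hne : (Finset.univ.filter fun i => f.1 i = some ⟨t, a, ha⟩).card ≠ 0 :=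
      fun h0 => hS (h0 ▸ h)
    obtain ⟨i, hi⟩ := Finset.card_ne_zero.1 hne
    exact ⟨i, by simp [(Finset.mem_filter.1 hi).2, ι]⟩
  · simp only [hι'.eq_iff]
    have h := f.2 (f.1 i)
    have hne : (Finset.univ.filter fun i' => f.1 i' = f.1 i).card ≠ 0 :=
      Finset.card_ne_zero.2 ⟨i, by simp⟩
    rcases hi : f.1 i with _ | c
    · rw [hi] at h hne
      exact (Set.mem_insert_iff.1 h).resolve_left hne
    · rw [hi] at h
      exact h
  · intro f f' h
    ext1
    funext i
    exact hι' (congrFun (congrArg Subtype.val h) i)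
  · rintro ⟨f, hf, hfS⟩
    have hex : ∀ i, ∃ c, Option.map ι c = f i := by
      intro i
      rcases hi : f i with _ | ⟨t, a⟩
      · exact ⟨none, rfl⟩
      · exact ⟨some ⟨t, a, (hf t a).1 ⟨i, hi⟩⟩, rfl⟩
    choose F hF using hex
    have hFS : ∀ i, (Finset.univ.filter fun i' => F i' = F i).card ∈ S := by
      intro i
      have := hfS i
      simpa only [← hF, hι'.eq_iff] using this
    refine ⟨⟨F, fun c => ?_⟩, Subtype.ext (funext hF)⟩
    by_cases hc : ∃ i, F i = c
    · obtain ⟨i, rfl⟩ := hc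
      rcases hi : F i with _ | c
      · exact Set.mem_insert_of_mem _ (hi ▸ hFS i)
      · exact (hi ▸ hFS i : (Finset.univ.filter fun i' => F i' = some c).card ∈ S)
    · rcases c with _ | ⟨t, a⟩
      · refine Set.mem_insert_iff.2 (Or.inl ?_)
        rw [Finset.card_eq_zero, Finset.filter_eq_empty_iff]
        exact fun i _ hi => hc ⟨i, hi⟩
      · obtain ⟨i, hi⟩ := (hf t a).2 a.2
        exact absurd ⟨i, hι' (by rw [hF, hi]; rfl)⟩ hc

lemma finite_restrictedLevels (α : Type*) [Fintype α] {r : ℕ} (m : Fin r → ℕ) {S : Set ℕ}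
    (hS : 0 ∉ S) : Finite (RestrictedLevels α m S) := by
  classical
  obtain ⟨e⟩ := nonempty_equiv_restrictedLevels α m hS
  exact Finite.of_equiv _ e

lemma card_restrictedLevels (α : Type*) [Fintype α] {r : ℕ} (m : Fin r → ℕ) {S : Set ℕ}
    (hS : 0 ∉ S) : (Nat.card (RestrictedLevels α m S) : ℚ) =
      (Fintype.card α)! *
        PowerSeries.coeff (Fintype.card α) ((1 + E S) * E S ^ ∑ t, m t) := by
  classical
  obtain ⟨e⟩ := nonempty_equiv_restrictedLevels α m hS
  have hprod : ∏ c, E (allowedSizes m S c) = (1 + E S) * E S ^ ∑ t, m t := by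
    rw [Fintype.prod_option]
    simp [allowedSizes, E_insert_zero hS]
  have h := card_filter_fiber_card_mem (α := α) (allowedSizes m S)
  rw [hprod] at h
  rw [← h, ← Fintype.card_subtype, ← Nat.card_eq_fintype_card, Nat.cast_inj]
  exact (Nat.card_congr e).symm

lemma IsLabelling.isRestricted_iff {n k r : ℕ} {M : ZeroOneMatrix n k}
    {f : Fin n → Option (Fin r × ℕ)} {g : Fin k → Option (Fin r × ℕ)} {m : Fin r → ℕ}
    (h : IsLabelling (fun i j => M i j = 1) f g m) (S₁ S₂ : Set ℕ) :
    IsRestricted S₁ S₂ M ↔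
      (∀ i, (Finset.univ.filter fun i' => f i' = f i).card ∈ S₁) ∧
      ∀ j, (Finset.univ.filter fun j' => g j' = g j).card ∈ S₂ := by
  have hbit : ∀ a b : Fin 2, (a = 1 ↔ b = 1) ↔ a = b := by decide
  have hrow : ∀ i i', M.row i' = M.row i ↔ f i' = f i := by
    intro i i'
    rw [← h.row_eq_iff, funext_iff]
    exact forall_congr' fun j => (hbit _ _).symm
  have hcol : ∀ j j', M.col j' = M.col j ↔ g j' = g j := by
    intro j j'
    rw [← h.col_eq_iff, funext_iff]
    exact forall_congr' fun i => (hbit _ _).symm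
  simp only [IsRestricted, hrow, hcol]

/-- Different levels need different rows. This confines `m` to a finite box. -/
lemma IsLabelling.level_count_le {α β : Type*} [Fintype α] {r : ℕ} {R : α → β → Prop}
    {f : α → Option (Fin r × ℕ)} {g : β → Option (Fin r × ℕ)} {m : Fin r → ℕ}
    (h : IsLabelling R f g m) (t : Fin r) : m t ≤ Fintype.card α := by
  have hex : ∀ a : Fin (m t), ∃ i, f i = some (t, (a : ℕ)) := fun a => (h.2.1 t a).2 a.2
  choose i hi using hex
  have : Function.Injective i := by
    intro a b hab
    have h1 := hi a
    rw [hab, hi b] at h1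
    simp only [Option.some.injEq, Prod.mk.injEq, true_and] at h1
    exact Fin.ext h1.symm
  simpa using Fintype.card_le_of_injective i this

lemma level_count_unique {α : Type*} {r : ℕ}
    {f : α → Option (Fin r × ℕ)} {m m' : Fin r → ℕ}
    (h : ∀ t a, (∃ i, f i = some (t, a)) ↔ a < m t)
    (h' : ∀ t a, (∃ i, f i = some (t, a)) ↔ a < m' t) : m = m' := by
  funext t
  have : ∀ a, a < m t ↔ a < m' t := fun a => (h t a).symm.trans (h' t a)
  exact le_antisymm (by simpa using (this (m' t)).not) (by simpa using (this (m t)).not)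

/-! ### Double counting of labelled matrices -/

/-- Labelled decomposable matrices, counted by matrices and by labellings. -/
lemma factorial_mul_numOfOrder (r : ℕ) (S₁ S₂ : Set ℕ) (n k : ℕ) :
    r ! * numOfOrder r S₁ S₂ n k =
      Nat.card (Σ m : Fintype.piFinset fun _ : Fin r => Finset.Icc 1 n,
        RestrictedLevels (Fin n) m.1 S₁ × RestrictedLevels (Fin k) m.1 S₂) := by
  classical
  let Good := {M : ZeroOneMatrix n k // HasDecompositionOrder M r ∧ IsRestricted S₁ S₂ M}
  let Lab : ZeroOneMatrix n k → Type := fun M =>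
    {p : (Fin n → Option (Fin r × ℕ)) × (Fin k → Option (Fin r × ℕ)) //
        ∃ m, IsLabelling (fun i j => M i j = 1) p.1 p.2 m}
  have hLab : Nat.card (Σ M : Good, Lab M.1) = r ! * numOfOrder r S₁ S₂ n k := by
    have e : (Σ M : Good, Lab M.1) ≃ Good × Equiv.Perm (Fin r) :=
      (Equiv.sigmaCongrRight fun M => (Classical.choice
        (nonempty_equiv_labellings M.2.1.exists_isLabelling)).symm).trans
        (Equiv.sigmaEquivProd _ _)
    rw [Nat.card_congr e, Nat.card_prod, Nat.card_perm, Nat.card_fin, mul_comm]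
    rfl
  rw [← hLab]
  symm
  -- A labelling determines its matrix, so pairs (matrix, labelling) amount to label maps with a
  -- common `m`.
  let mat : (Fin n → Option (Fin r × ℕ)) → (Fin k → Option (Fin r × ℕ)) → ZeroOneMatrix n k :=
    fun f g => Matrix.of fun i j =>
      if ∃ t a b, f i = some (t, a) ∧ g j = some (t, b) ∧ a ≤ b then 1 else 0
  have hmat : ∀ f g i j, mat f g i j = 1 ↔
      ∃ t a b, f i = some (t, a) ∧ g j = some (t, b) ∧ a ≤ b := by
    intro f g i j
    simp only [mat, Matrix.of_apply]
    split_ifs with h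
    · simp only [h]
    · simp only [h, iff_false]; decide
  have hlab : ∀ (m : Fintype.piFinset fun _ : Fin r => Finset.Icc 1 n)
      (f : RestrictedLevels (Fin n) m.1 S₁) (g : RestrictedLevels (Fin k) m.1 S₂),
      IsLabelling (fun i j => mat f.1 g.1 i j = 1) f.1 g.1 m.1 := by
    intro m f g
    refine ⟨fun t => ?_, f.2.1, g.2.1, hmat _ _⟩
    have := Fintype.mem_piFinset.1 m.2 t
    rw [Finset.mem_Icc] at this
    omega
  refine Nat.card_eq_of_bijective (fun x => ⟨⟨mat x.2.1.1 x.2.2.1,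
    (hlab x.1 x.2.1 x.2.2).hasDecompositionOrder,
    ((hlab x.1 x.2.1 x.2.2).isRestricted_iff S₁ S₂).2 ⟨x.2.1.2.2, x.2.2.2.2⟩⟩,
    (x.2.1.1, x.2.2.1), x.1.1, hlab x.1 x.2.1 x.2.2⟩) ⟨?_, ?_⟩
  · rintro ⟨⟨m, hm⟩, ⟨f, hf⟩, ⟨g, hg⟩⟩ ⟨⟨m', hm'⟩, ⟨f', hf'⟩, ⟨g', hg'⟩⟩ h
    have h2 : (f, g) = (f', g') := congrArg
      (fun y : Σ M : Good, Lab M.1 => y.2.1) h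
    obtain ⟨rfl, rfl⟩ := Prod.mk.inj h2
    obtain rfl := level_count_unique hf.1 hf'.1
    rfl
  · rintro ⟨⟨M, hM, hMS⟩, ⟨f, g⟩, m, h⟩
    have hMS' := (h.isRestricted_iff S₁ S₂).1 hMS
    have hm : m ∈ Fintype.piFinset fun _ : Fin r => Finset.Icc 1 n := by
      rw [Fintype.mem_piFinset]
      intro t
      rw [Finset.mem_Icc]
      exact ⟨h.1 t, by simpa using h.level_count_le t⟩
    have hfg : mat f g = M := by
      refine Matrix.ext fun i j => ?_
      have h1 := (hmat f g i j).trans (h.2.2.2 i j).symm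
      exact (by decide : ∀ a b : Fin 2, (a = 1 ↔ b = 1) → a = b) _ _ h1
    subst hfg
    exact ⟨⟨⟨m, hm⟩, ⟨f, h.2.1, hMS'.1⟩, ⟨g, h.2.2.1, hMS'.2⟩⟩, rfl⟩

lemma factorial_mul_numOfOrder_eq_sum (r : ℕ) {S₁ S₂ : Set ℕ} (hS₁ : 0 ∉ S₁) (hS₂ : 0 ∉ S₂)
    (n k : ℕ) : (r ! * numOfOrder r S₁ S₂ n k : ℚ) =
      n ! * k ! * ∑ m ∈ Fintype.piFinset fun _ : Fin r => Finset.Icc 1 n,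
        PowerSeries.coeff n ((1 + E S₁) * E S₁ ^ ∑ t, m t) *
          PowerSeries.coeff k ((1 + E S₂) * E S₂ ^ ∑ t, m t) := by
  have := fun m : Fin r → ℕ => finite_restrictedLevels (Fin n) m hS₁
  have := fun m : Fin r → ℕ => finite_restrictedLevels (Fin k) m hS₂
  have h := factorial_mul_numOfOrder r S₁ S₂ n k
  rw [Nat.card_sigma] at h
  rw [← Nat.cast_mul, h, Nat.cast_sum, Finset.mul_sum, Finset.univ_eq_attach,
    ← Finset.sum_attach (Fintype.piFinset fun _ : Fin r => Finset.Icc 1 n)]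
  refine Finset.sum_congr rfl fun m _ => ?_
  rw [Nat.card_prod, Nat.cast_mul, card_restrictedLevels _ _ hS₁, card_restrictedLevels _ _ hS₂]
  simp only [Fintype.card_fin]
  ring

/-! ### Bivariate series: geometric sum and exponential -/

lemma coeff_subst_X_zero_mul_subst_X_one (f g : PowerSeries ℚ) (d : Fin 2 →₀ ℕ) :
    MvPowerSeries.coeff d ((f.subst (MvPowerSeries.X 0 : BivariateSeries) : BivariateSeries) *
      g.subst (MvPowerSeries.X 1 : BivariateSeries)) =
      PowerSeries.coeff (d 0) f * PowerSeries.coeff (d 1) g := by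
  have hd : Finsupp.single 0 (d 0) + Finsupp.single 1 (d 1) = d := by
    ext i
    fin_cases i <;> simp
  rw [MvPowerSeries.coeff_mul,
    Finset.sum_eq_single (Finsupp.single 0 (d 0), Finsupp.single 1 (d 1))]
  · simp [PowerSeries.coeff_subst_single]
  · rintro ⟨a, b⟩ hab hne
    rw [PowerSeries.coeff_subst_single, PowerSeries.coeff_subst_single]
    by_contra h
    obtain ⟨h0, h1⟩ := ne_zero_and_ne_zero_of_mul h
    simp only [ne_eq, ite_eq_right_iff, not_forall, exists_prop] at h0 h1
    refine hne ?_
    rw [← Finset.HasAntidiagonal.mem_antidiagonal.1 hab, h0.1, h1.1]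
    simp
  · intro h
    exact absurd (Finset.HasAntidiagonal.mem_antidiagonal.2 hd) h

lemma coeff_one_add_mul_pow (S₁ S₂ : Set ℕ) (l : ℕ) (d : Fin 2 →₀ ℕ) :
    MvPowerSeries.coeff d ((1 + Ex S₁) * (1 + Ey S₂) * (Ex S₁ * Ey S₂) ^ l) =
      PowerSeries.coeff (d 0) ((1 + E S₁) * E S₁ ^ l) *
        PowerSeries.coeff (d 1) ((1 + E S₂) * E S₂ ^ l) := by
  have h : ∀ (i : Fin 2) (S : Set ℕ),
      ((1 + E S) * E S ^ l).subst (MvPowerSeries.X i : BivariateSeries) =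
        (1 + (E S).subst (MvPowerSeries.X i : BivariateSeries)) *
          (E S).subst (MvPowerSeries.X i : BivariateSeries) ^ l := by
    intro i S
    simp only [← PowerSeries.coe_substAlgHom (PowerSeries.HasSubst.X i), map_mul, map_add,
      map_one, map_pow]
  rw [← coeff_subst_X_zero_mul_subst_X_one, h, h, Ex, Ey, mul_pow]
  congr 1
  ring

lemma constantCoeff_E {S : Set ℕ} (hS : 0 ∉ S) : PowerSeries.constantCoeff (E S) = 0 := by
  rw [← PowerSeries.coeff_zero_eq_constantCoeff_apply]
  simp [E, hS]

lemma X_zero_dvd_Ex {S : Set ℕ} (hS : 0 ∉ S) : MvPowerSeries.X 0 ∣ Ex S := by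
  rw [MvPowerSeries.X_dvd_iff]
  intro d hd
  rw [Ex, PowerSeries.coeff_subst_single, hd, PowerSeries.coeff_zero_eq_constantCoeff_apply,
    constantCoeff_E hS, ite_self]

section Geometric

variable {w : BivariateSeries}

lemma inv_one_sub_sub_one (hw : MvPowerSeries.X 0 ∣ w) :
    (1 - w)⁻¹ - 1 = w * (1 + ((1 - w)⁻¹ - 1)) := by
  have hc : MvPowerSeries.constantCoeff w = 0 := by
    obtain ⟨v, rfl⟩ := hw
    simp
  have h := MvPowerSeries.mul_inv_cancel (1 - w) (by simp [hc])
  linear_combination h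

lemma inv_one_sub_sub_one_eq_sum (hw : MvPowerSeries.X 0 ∣ w) (N : ℕ) :
    (1 - w)⁻¹ - 1 = ∑ a ∈ Finset.Icc 1 N, w ^ a + w ^ N * ((1 - w)⁻¹ - 1) := by
  induction N with
  | zero => simp
  | succ N ih =>
    rw [Finset.sum_Icc_succ_top (by omega)]
    linear_combination ih + w ^ N * inv_one_sub_sub_one hw

lemma X_zero_dvd_inv_one_sub_sub_one (hw : MvPowerSeries.X 0 ∣ w) :
    MvPowerSeries.X 0 ∣ (1 - w)⁻¹ - 1 := by
  rw [inv_one_sub_sub_one hw]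
  exact hw.mul_right _

lemma coeff_mul_eq_of_dvd_sub {C A B : BivariateSeries} {d : Fin 2 →₀ ℕ}
    (h : MvPowerSeries.X 0 ^ (d 0 + 1) ∣ A - B) :
    MvPowerSeries.coeff d (C * A) = MvPowerSeries.coeff d (C * B) := by
  have := MvPowerSeries.X_pow_dvd_iff.1 (h.mul_left C) d (Nat.lt_succ_self _)
  rwa [mul_sub, map_sub, sub_eq_zero] at this

/-- Cutting the geometric series after `w ^ d 0` leaves an error divisible by `X 0 ^ (d 0 + 1)`,
invisible at `d`. Expanding the power gives the same box of tuples `m` as in the count. -/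
lemma coeff_mul_inv_one_sub_sub_one_pow (hw : MvPowerSeries.X 0 ∣ w) (C : BivariateSeries)
    (r : ℕ) (d : Fin 2 →₀ ℕ) :
    MvPowerSeries.coeff d (C * ((1 - w)⁻¹ - 1) ^ r) =
      ∑ m ∈ Fintype.piFinset fun _ : Fin r => Finset.Icc 1 (d 0),
        MvPowerSeries.coeff d (C * w ^ ∑ t, m t) := by
  rw [coeff_mul_eq_of_dvd_sub (B := (∑ a ∈ Finset.Icc 1 (d 0), w ^ a) ^ r), Finset.sum_pow',
    Finset.mul_sum, map_sum]
  · simp only [Finset.prod_pow_eq_pow_sum]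
  · refine dvd_trans ?_ (sub_dvd_pow_sub_pow _ _ r)
    nth_rewrite 1 [inv_one_sub_sub_one_eq_sum hw (d 0)]
    rw [add_sub_cancel_left, pow_succ]
    exact mul_dvd_mul (pow_dvd_pow_of_dvd hw _) (X_zero_dvd_inv_one_sub_sub_one hw)

lemma coeff_mul_exp_subst {u : BivariateSeries} (hu : MvPowerSeries.X 0 ∣ u)
    (C : BivariateSeries) (d : Fin 2 →₀ ℕ) :
    MvPowerSeries.coeff d (C * (PowerSeries.exp ℚ).subst u) =
      ∑ r ∈ Finset.range (d 0 + 1), MvPowerSeries.coeff d ((1 / (r ! : ℚ)) • (C * u ^ r)) := by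
  have hc : MvPowerSeries.constantCoeff u = 0 := by
    obtain ⟨v, rfl⟩ := hu
    simp
  rw [coeff_mul_eq_of_dvd_sub
    (B := ∑ r ∈ Finset.range (d 0 + 1), (1 / (r ! : ℚ)) • u ^ r), Finset.mul_sum, map_sum]
  · simp only [mul_smul_comm]
  · rw [MvPowerSeries.X_pow_dvd_iff]
    intro e he
    rw [map_sub, sub_eq_zero,
      PowerSeries.coeff_subst (PowerSeries.HasSubst.of_constantCoeff_zero hc),
      finsum_eq_sum_of_support_subset (s := Finset.range (d 0 + 1)), map_sum]
    · refine Finset.sum_congr rfl fun r _ => ?_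
      simp [PowerSeries.coeff_exp]
    · intro r hr
      by_contra hr'
      simp only [Finset.coe_range, Set.mem_Iio, not_lt] at hr'
      refine hr (show _ • MvPowerSeries.coeff e (u ^ r) = 0 from ?_)
      rw [MvPowerSeries.X_pow_dvd_iff.1 (pow_dvd_pow_of_dvd hu r) e (by omega), smul_zero]

end Geometric

/-- Level-0 rows of different blocks differ. The bound matches the truncation of the exponential at
`r ≤ d 0`. -/
lemma HasDecompositionOrder.le_rows {n k r : ℕ} {M : ZeroOneMatrix n k}
    (h : HasDecompositionOrder M r) : r ≤ n := by
  obtain ⟨f, g, m, h⟩ := h.exists_isLabelling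
  choose i hi using fun t => (h.2.1 t 0).2 (h.1 t)
  have : Function.Injective i := by
    intro t u htu
    have h1 := hi t
    rw [htu, hi u] at h1
    simpa using h1.symm
  simpa using Fintype.card_le_of_injective i this

lemma numDecomposable_eq_sum (S₁ S₂ : Set ℕ) (n k : ℕ) :
    numDecomposable S₁ S₂ n k = ∑ r ∈ Finset.range (n + 1), numOfOrder r S₁ S₂ n k := by
  rw [Finset.sum_range, numDecomposable]
  simp only [numOfOrder]
  rw [← Nat.card_sigma]
  symm
  refine Nat.card_eq_of_bijective (fun x => ⟨x.2.1, ?_, x.2.2.2⟩) ⟨?_, ?_⟩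
  · obtain ⟨s, p, q, L, hL, hM, -⟩ := x.2.2.1
    exact ⟨s, p, q, L, hL, hM⟩
  · rintro ⟨r, M, hM⟩ ⟨r', M', hM'⟩ h
    obtain rfl : M = M' := congrArg Subtype.val h
    obtain rfl : r = r' := Fin.ext (hM.1.unique hM'.1)
    rfl
  · rintro ⟨M, ⟨s, p, q, L, hL, hM⟩, hMS⟩
    have h : HasDecompositionOrder M _ := ⟨s, p, q, L, hL, hM, rfl⟩
    exact ⟨⟨⟨_, Nat.lt_succ_of_le h.le_rows⟩, M, h, hMS⟩, rfl⟩

lemma coeff_egf (a : ℕ → ℕ → ℕ) (d : Fin 2 →₀ ℕ) :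
    MvPowerSeries.coeff d (egf a) = (a (d 0) (d 1) : ℚ) / ((d 0)! * (d 1)!) := rfl

lemma egf_numOfOrder (r : ℕ) {S₁ S₂ : Set ℕ} (hS₁ : 0 ∉ S₁) (hS₂ : 0 ∉ S₂) :
    egf (numOfOrder r S₁ S₂) = (1 / (r ! : ℚ)) •
      ((1 + Ex S₁) * (1 + Ey S₂) * ((1 - Ex S₁ * Ey S₂)⁻¹ - 1) ^ r) := by
  ext d
  have h := factorial_mul_numOfOrder_eq_sum r hS₁ hS₂ (d 0) (d 1)
  rw [MvPowerSeries.coeff_smul,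
    coeff_mul_inv_one_sub_sub_one_pow ((X_zero_dvd_Ex hS₁).mul_right _), coeff_egf]
  simp only [coeff_one_add_mul_pow]
  have h0 : ((d 0)! : ℚ) ≠ 0 := by exact_mod_cast (d 0).factorial_ne_zero
  have h1 : ((d 1)! : ℚ) ≠ 0 := by exact_mod_cast (d 1).factorial_ne_zero
  have hr : (r ! : ℚ) ≠ 0 := by exact_mod_cast r.factorial_ne_zero
  field_simp
  linear_combination h

end LonesumDecomposable

theorem mainTheorem4 (S₁ S₂ : Set ℕ) (hS₁ : ∀ s ∈ S₁, 0 < s) (hS₂ : ∀ s ∈ S₂, 0 < s) :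
    (∀ r : ℕ,
      LonesumDecomposable.egf (LonesumDecomposable.numOfOrder r S₁ S₂) =
        (1 / (r ! : ℚ)) •
          ((1 + LonesumDecomposable.Ex S₁) * (1 + LonesumDecomposable.Ey S₂) *
            ((1 - LonesumDecomposable.Ex S₁ * LonesumDecomposable.Ey S₂)⁻¹ - 1) ^ r)) ∧
    LonesumDecomposable.egf (LonesumDecomposable.numDecomposable S₁ S₂) =
      (1 + LonesumDecomposable.Ex S₁) * (1 + LonesumDecomposable.Ey S₂) *
        (PowerSeries.exp ℚ).subst
          ((1 - LonesumDecomposable.Ex S₁ * LonesumDecomposable.Ey S₂)⁻¹ - 1) := by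
  have h₁ : 0 ∉ S₁ := fun h => (hS₁ 0 h).false
  have h₂ : 0 ∉ S₂ := fun h => (hS₂ 0 h).false
  refine ⟨fun r => LonesumDecomposable.egf_numOfOrder r h₁ h₂, ?_⟩
  ext d
  rw [LonesumDecomposable.coeff_mul_exp_subst
    (LonesumDecomposable.X_zero_dvd_inv_one_sub_sub_one
      ((LonesumDecomposable.X_zero_dvd_Ex h₁).mul_right _))]
  simp only [← LonesumDecomposable.egf_numOfOrder _ h₁ h₂, LonesumDecomposable.coeff_egf,
    LonesumDecomposable.numDecomposable_eq_sum, Nat.cast_sum, Finset.sum_div]
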